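/- Let $K$ be a field, let $n$ and $t$ be integers with $1<t<n-1$, and let $C_n$ be the cycle graph on $n$ vertices. Let $S=K[x_1,\dots,x_n]$ with graded maximal ideal $\mathfrak m=(x_1,\dots,x_n)$, and let $I_t(C_n)\subseteq S$ be the $t$-path ideal of $C_n$, i.e. the ideal generated by the monomials $x_{i_1}\cdots x_{i_t}$ such that $i_1,\dots,i_t$ is the sequence of vertices of a path with $t$ vertices in $C_n$. Let $F(I_t(C_n))=R(I_t(C_n))/\mathfrak m R(I_t(C_n))$ be its fiber cone, where $R(I)=\bigoplus_{k\ge 0} I^k s^k\subseteq S[s]$ is the Rees algebra of $I$. Let $d=\gcd(n,t)$. Then the Krull dimension of $F(I_t(C_n))$ is $n-d+1$. Moreover, $F(I_t(C_n))$ is a polynomial ring (i.e. isomorphic as a $K$-algebra to a polynomial ring over $K$ in finitely many variables) if and only if $\gcd(n,t)=1$. -/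

import Mathlib

/-- The `t`-path ideal of a simple graph `G` in the polynomial ring over `K` whose variables are the
vertices of `G`: it is generated by the monomials `x_{i₁} ⋯ x_{iₜ}`, where `i₁, …, iₜ` is the
sequence of vertices of a path with `t` vertices (that is, with `t - 1` edges) in `G`. -/
noncomputable def pathIdeal (K : Type*) [Field K] {V : Type*} (G : SimpleGraph V) (t : ℕ) :
    Ideal (MvPolynomial V K) :=
  Ideal.span {f | ∃ (u v : V) (p : G.Walk u v), p.IsPath ∧ p.length + 1 = t ∧
    f = (p.support.map fun i => (MvPolynomial.X i : MvPolynomial V K)).prod}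

/-- The fiber cone `F(I) = R(I) / 𝔪 R(I)` of an ideal `I` of a polynomial ring over `K`, where
`R(I)` is the Rees algebra of `I` and `𝔪` is the ideal generated by all the variables. -/
abbrev FiberCone {K V : Type*} [Field K] (I : Ideal (MvPolynomial V K)) : Type _ :=
  reesAlgebra I ⧸ (Ideal.span (Set.range (MvPolynomial.X : V → MvPolynomial V K))).map
    (algebraMap (MvPolynomial V K) (reesAlgebra I))

/-- A `K`-algebra is a polynomial ring over `K` if it is isomorphic, as a `K`-algebra, to the
polynomial ring over `K` in finitely many variables. -/
def IsPolynomialRing (K A : Type*) [Field K] [CommRing A] [Algebra K A] : Prop :=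
  ∃ m : ℕ, Nonempty (A ≃ₐ[K] MvPolynomial (Fin m) K)

/-! The ideal is generated by the monomials of the `n` cyclic windows of length `t` in `ZMod n`. As
they share one degree, the fiber cone is the subalgebra `K[x^w_i]` they generate
(`nonempty_fiberCone_algEquiv`), whose dimension is the rank of the exponent vectors `w_i`.

Let `d = gcd(n, t)`. A linear relation among the windows has `t`-periodic, hence `d`-periodic,
coefficients; conversely the sum of windows over a residue class mod `d` does not depend on the
class. So dropping the least member of every class but one, i.e. the indices `0, …, d - 2`, leaves a
basis of `n - d + 1` windows.

If `d = 1` all windows are independent and the cone is polynomial. Conversely, a polynomial ring in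
`m` variables has dimension `m`, while the `n` distinct generators of lowest positive degree force
`n ≤ m`; thus `n ≤ n - d + 1` and `d = 1`. -/

/-! ### Krull dimension of monomial algebras -/

theorem ringKrullDim_eq_of_isIntegral_of_injective (R S : Type*) [CommRing R] [CommRing S]
    [Algebra R S] [Algebra.IsIntegral R S] (h : Function.Injective (algebraMap R S)) :
    ringKrullDim R = ringKrullDim S := by
  apply le_antisymm
  · refine iSup_le fun l => ?_
    obtain ⟨Q, hQ, hQ', hQ''⟩ := Ideal.exists_ideal_over_prime_of_isIntegral l.head.asIdeal
      (⊥ : Ideal S) (by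
        rw [← RingHom.ker_eq_comap_bot, (RingHom.injective_iff_ker_eq_bot _).1 h]; exact bot_le)
    have : Q.LiesOver l.head.asIdeal := ⟨hQ''.symm⟩
    obtain ⟨L, hL, -⟩ := Ideal.exists_ltSeries_of_hasGoingUp l Q
    rw [← hL]
    exact le_iSup (fun l : LTSeries (PrimeSpectrum S) => (l.length : WithBot ℕ∞)) L
  · refine Order.krullDim_le_of_strictMono (PrimeSpectrum.comap (algebraMap R S)) ?_
    intro P Q hPQ
    exact Ideal.IsIntegral.comap_lt_comap (R := R) (I := P.asIdeal) (J := Q.asIdeal) hPQ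

/-- Noether normalization makes `A` integral over `s` variables; both `s` and the size of `ι` are
the transcendence degree. -/
theorem ringKrullDim_eq_natCard_of_algebraicIndependent {K A ι : Type*} [Field K] [CommRing A]
    [IsDomain A] [Algebra K A] [Algebra.FiniteType K A] [Finite ι] {x : ι → A}
    (hx : AlgebraicIndependent K x)
    (halg : Algebra.IsAlgebraic (Algebra.adjoin K (Set.range x)) A) :
    ringKrullDim A = (Nat.card ι : WithBot ℕ∞) := by
  obtain ⟨s, g, hg, hint⟩ := exists_integral_inj_algHom_of_fg K A
  have hb := hx.isTranscendenceBasis_iff_isAlgebraic.2 halg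
  let _ := g.toRingHom.toAlgebra
  have : IsScalarTower K (MvPolynomial (Fin s) K) A :=
    IsScalarTower.of_algebraMap_eq fun r => (g.commutes r).symm
  have : Algebra.IsIntegral (MvPolynomial (Fin s) K) A := ⟨hint⟩
  have : FaithfulSMul (MvPolynomial (Fin s) K) A := (faithfulSMul_iff_algebraMap_injective _ _).2 hg
  have htr := lift_trdeg_add_eq K (MvPolynomial (Fin s) K) A
  rw [trdeg_eq_zero (R := MvPolynomial (Fin s) K),
    MvPolynomial.trdeg_of_isDomain] at htr
  have : Nat.card ι = s := by
    have h₁ := congrArg Cardinal.toNat hb.lift_cardinalMk_eq_trdeg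
    have h₂ := congrArg Cardinal.toNat htr
    simp only [Cardinal.toNat_lift, Cardinal.lift_zero, add_zero, Cardinal.mk_fin,
      Cardinal.toNat_natCast] at h₁ h₂
    rw [Nat.card, h₁, ← h₂]
  rw [← ringKrullDim_eq_of_isIntegral_of_injective (MvPolynomial (Fin s) K) A hg, this]
  simp

theorem algebraicIndependent_monomial {K ι V : Type*} [Field K] (e : ι → V →₀ ℕ)
    (he : Function.Injective fun u : ι →₀ ℕ => u.sum fun i k => k • e i) :
    AlgebraicIndependent K fun i => (MvPolynomial.monomial (e i) 1 : MvPolynomial V K) := by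
  let f : (ι →₀ ℕ) →+ (V →₀ ℕ) := Finsupp.liftAddHom fun i =>
    (AddMonoidHom.flip (smulAddHom ℕ (V →₀ ℕ))) (e i)
  have h : MvPolynomial.aeval (fun i => (MvPolynomial.monomial (e i) 1 : MvPolynomial V K)) =
      AddMonoidAlgebra.mapDomainAlgHom K K f := by
    apply MvPolynomial.algHom_ext
    intro i
    have : f (Finsupp.single i 1) = e i := by simp [f]
    rw [MvPolynomial.aeval_X, ← this]
    exact (AddMonoidAlgebra.mapDomain_single (f := f)).symm
  rw [AlgebraicIndependent, h]
  exact AddMonoidAlgebra.mapDomain_injective he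

theorem isAlgebraic_of_mul_mem {K A : Type*} [Field K] [CommRing A] [IsDomain A] [Algebra K A]
    (B : Subalgebra K A) {a b : A} (hb : b ∈ B) (hb0 : b ≠ 0) (hab : a * b ∈ B) :
    IsAlgebraic B a := by
  refine ⟨Polynomial.C ⟨b, hb⟩ * Polynomial.X - Polynomial.C ⟨a * b, hab⟩, ?_, ?_⟩
  · intro h
    have := congrArg (fun p => p.coeff 1) h
    simp [Polynomial.coeff_C] at this
    exact hb0 (congrArg Subtype.val this)
  · rw [map_sub, map_mul, Polynomial.aeval_X, Polynomial.aeval_C, Polynomial.aeval_C]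
    change b * a - a * b = 0
    ring

/-- By `hB`, each remaining generator is a quotient of products of generators from `B`, so it is
algebraic over them. -/
theorem ringKrullDim_aeval_monomial_range {K ι V : Type*} [Field K] [Finite ι] (e : ι → V →₀ ℕ)
    (B : Set ι)
    (he : Function.Injective fun u : B →₀ ℕ => u.sum fun i k => k • e i)
    (hB : ∀ i ∉ B, ∃ s s' : Finset ι, ↑s ⊆ B ∧ ↑s' ⊆ B ∧ e i + ∑ j ∈ s, e j = ∑ j ∈ s', e j) :
    ringKrullDim (MvPolynomial.aeval (R := K)
        fun i => (MvPolynomial.monomial (e i) 1 : MvPolynomial V K)).range =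
      (Nat.card B : WithBot ℕ∞) := by
  set φ := MvPolynomial.aeval (R := K) fun i => (MvPolynomial.monomial (e i) 1 : MvPolynomial V K)
    with hφ
  let x : ι → φ.range := fun i => ⟨φ (MvPolynomial.X i), MvPolynomial.X i, rfl⟩
  have hx : ∀ i, (x i : MvPolynomial V K) = MvPolynomial.monomial (e i) 1 := fun i => by
    simp [x, hφ]
  have : Algebra.FiniteType K φ.range :=
    Algebra.FiniteType.of_surjective φ.rangeRestrict φ.rangeRestrict_surjective
  have hind : AlgebraicIndependent K fun i : B => x i := by
    apply AlgebraicIndependent.of_comp φ.range.val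
    convert algebraicIndependent_monomial (K := K) (fun i : B => e i) he using 2 with i
    exact hx i
  refine ringKrullDim_eq_natCard_of_algebraicIndependent hind ?_
  set R := Algebra.adjoin K (Set.range fun i : B => x i)
  have hmem : ∀ i ∈ B, x i ∈ R := fun i hi => Algebra.subset_adjoin ⟨⟨i, hi⟩, rfl⟩
  have hgen : ∀ i, IsAlgebraic R (x i) := by
    intro i
    by_cases hi : i ∈ B
    · exact isAlgebraic_algebraMap (⟨x i, hmem i hi⟩ : R)
    · obtain ⟨s, s', hs, hs', h⟩ := hB i hi
      refine isAlgebraic_of_mul_mem R (b := ∏ j ∈ s, x j)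
        (prod_mem fun j hj => hmem j (hs hj)) ?_ ?_
      · rw [Finset.prod_ne_zero_iff]
        intro j _ h0
        have := congrArg Subtype.val h0
        rw [hx] at this
        simp at this
      · have : x i * ∏ j ∈ s, x j = ∏ j ∈ s', x j := by
          apply Subtype.ext
          simp only [MulMemClass.coe_mul, SubmonoidClass.coe_finsetProd, hx,
            ← MvPolynomial.monomial_sum_one, MvPolynomial.monomial_mul, h, one_mul]
        rw [this]
        exact prod_mem fun j hj => hmem j (hs' hj)
  constructor
  rintro ⟨_, p, rfl⟩
  change IsAlgebraic R (φ.rangeRestrict p)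
  induction p using MvPolynomial.induction_on with
  | C a =>
    have : φ.rangeRestrict (MvPolynomial.C a) =
        algebraMap R φ.range (algebraMap K R a) := φ.rangeRestrict.commutes a
    rw [this]
    exact isAlgebraic_algebraMap _
  | add p q hp hq => rw [map_add]; exact hp.add hq
  | mul_X p i hp => rw [map_mul]; exact hp.mul (hgen i)

/-! ### Fiber cones of monomial ideals generated in one degree -/

open MvPolynomial in
theorem homogeneousComponent_aeval_monomial {K ι V : Type*} [Field K] {e : ι → V →₀ ℕ} {t : ℕ}
    (ht : 0 < t) (he : ∀ i, (e i).degree = t) (p : MvPolynomial ι K) (k : ℕ) :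
    homogeneousComponent (k * t) (aeval (fun i => (monomial (e i) 1 : MvPolynomial V K)) p) =
      aeval (fun i => (monomial (e i) 1 : MvPolynomial V K)) (homogeneousComponent k p) := by
  have key : ∀ j, ∀ q : MvPolynomial ι K, q.IsHomogeneous j →
      (aeval (fun i => (monomial (e i) 1 : MvPolynomial V K)) q).IsHomogeneous (j * t) := by
    intro j q hq
    rw [mul_comm]
    exact hq.aeval _ fun i => isHomogeneous_monomial _ (he i)
  conv_lhs => rw [← sum_homogeneousComponent p, map_sum, map_sum]
  rw [Finset.sum_congr rfl fun j _ => homogeneousComponent_of_mem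
    (key j _ (homogeneousComponent_isHomogeneous j p))]
  simp only [Nat.mul_left_inj ht.ne', Finset.sum_ite_eq]
  split_ifs with h
  · rfl
  · rw [homogeneousComponent_eq_zero, map_zero]
    simpa [Nat.lt_succ_iff] using h

open MvPolynomial in
theorem coeff_aeval_monomial_one {K ι V : Type*} [Field K] (M : ι → MvPolynomial V K)
    (p : MvPolynomial ι K) (k : ℕ) :
    (aeval (fun i => Polynomial.monomial 1 (M i)) p).coeff k =
      aeval M (homogeneousComponent k p) := by
  induction p using MvPolynomial.induction_on' with
  | monomial u a =>
    have h : aeval (fun i => Polynomial.monomial 1 (M i)) (monomial u a) =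
        Polynomial.monomial u.degree (aeval M (monomial u a)) := by
      rw [aeval_monomial, aeval_monomial]
      simp only [Finsupp.prod, ← Polynomial.C_mul_X_eq_monomial, mul_pow, Finset.prod_mul_distrib,
        Finset.prod_pow_eq_pow_sum, ← Polynomial.C_pow, ← map_prod]
      rw [← mul_assoc, ← Polynomial.C_mul_X_pow_eq_monomial, map_mul]
      rfl
    rw [h, Polynomial.coeff_monomial, homogeneousComponent_of_mem
      (isHomogeneous_monomial a rfl)]
    simp only [eq_comm (a := k)]
    split_ifs <;> simp
  | add p q hp hq => simp [hp, hq]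

open MvPolynomial in
theorem coeff_mem_of_mem_map_idealOfVars {K V : Type*} [Field K] (I : Ideal (MvPolynomial V K))
    {f : reesAlgebra I}
    (hf : f ∈ (idealOfVars V K).map (algebraMap (MvPolynomial V K) (reesAlgebra I))) (k : ℕ) :
    (f : Polynomial (MvPolynomial V K)).coeff k ∈ idealOfVars V K * I ^ k := by
  induction hf using Submodule.span_induction generalizing k with
  | mem x hx =>
    obtain ⟨y, hy, rfl⟩ := hx
    have : ((algebraMap (MvPolynomial V K) (reesAlgebra I) y : reesAlgebra I) :
      Polynomial (MvPolynomial V K)) = Polynomial.C y := rfl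
    rw [this, Polynomial.coeff_C]
    split_ifs with h
    · subst h; simpa using hy
    · exact zero_mem _
  | zero => simp
  | add x y _ _ hx hy => simpa using add_mem (hx k) (hy k)
  | smul a x _ hx =>
    rw [smul_eq_mul, MulMemClass.coe_mul, Polynomial.coeff_mul]
    refine sum_mem fun ij hij => ?_
    rw [Finset.HasAntidiagonal.mem_antidiagonal] at hij
    rw [← hij, pow_add, mul_left_comm]
    exact Ideal.mul_mem_mul (a.2 ij.1) (hx ij.2)

-- The image is homogeneous of degree `t * k`, whereas `𝔪 I^k` lives in degrees at least `t * k +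
-- 1`.
open MvPolynomial in
theorem aeval_monomial_homogeneousComponent_eq_zero {K ι V : Type*} [Field K] {e : ι → V →₀ ℕ}
    {t : ℕ} (he : ∀ i, (e i).degree = t) (p : MvPolynomial ι K) (k : ℕ)
    (hp : aeval (fun i => (monomial (e i) 1 : MvPolynomial V K)) (homogeneousComponent k p) ∈
      idealOfVars V K * Ideal.span (Set.range fun i => monomial (e i) 1) ^ k) :
    aeval (fun i => (monomial (e i) 1 : MvPolynomial V K)) (homogeneousComponent k p) = 0 := by
  have hI : Ideal.span (Set.range fun i => (monomial (e i) 1 : MvPolynomial V K)) ≤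
      idealOfVars V K ^ t := by
    rw [Ideal.span_le]
    rintro _ ⟨i, rfl⟩
    exact (monomial_mem_pow_idealOfVars_iff _ _ one_ne_zero).2 (he i).ge
  have hm := Ideal.mul_mono_right (I := idealOfVars V K) (Ideal.pow_right_mono hI k) hp
  rw [← pow_mul, ← pow_succ', mem_pow_idealOfVars_iff'] at hm
  have hh := (homogeneousComponent_isHomogeneous k p).aeval _
    fun i => isHomogeneous_monomial (1 : K) (he i)
  ext d
  rw [coeff_zero]
  by_cases hd : d.degree = t * k
  · exact hm d (by omega)
  · exact hh.coeff_eq_zero hd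

open MvPolynomial in
theorem nonempty_fiberCone_algEquiv {K ι V : Type*} [Field K] {e : ι → V →₀ ℕ} {t : ℕ}
    (ht : 0 < t) (he : ∀ i, (e i).degree = t) (I : Ideal (MvPolynomial V K))
    (hI : I = Ideal.span (Set.range fun i => monomial (e i) 1)) :
    Nonempty (FiberCone I ≃ₐ[K]
      (aeval (R := K) fun i => (monomial (e i) 1 : MvPolynomial V K)).range) := by
  set M : ι → MvPolynomial V K := fun i => monomial (e i) 1 with hM
  have hMI : ∀ i, M i ∈ I := fun i => hI ▸ Ideal.subset_span ⟨i, rfl⟩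
  let θ : MvPolynomial ι K →ₐ[K] reesAlgebra I := aeval fun i =>
    ⟨Polynomial.monomial 1 (M i), reesAlgebra.monomial_mem.2 (by simpa using hMI i)⟩
  have hθ : ∀ p, (θ p : Polynomial (MvPolynomial V K)) =
      aeval (fun i => Polynomial.monomial 1 (M i)) p := by
    intro p
    have : ((reesAlgebra I).val.restrictScalars K).comp θ =
        aeval (fun i => Polynomial.monomial 1 (M i)) := by
      ext i : 1
      simp [θ]
    exact DFunLike.congr_fun this p
  let π : reesAlgebra I →ₐ[K] FiberCone I := Ideal.Quotient.mkₐ K _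
  let ψ : MvPolynomial ι K →ₐ[K] FiberCone I := π.comp θ
  have hπX : ∀ i, π (algebraMap (MvPolynomial V K) (reesAlgebra I) (X i)) = 0 := by
    intro i
    exact Ideal.Quotient.eq_zero_iff_mem.2 (Ideal.mem_map_of_mem _ (Ideal.subset_span ⟨i, rfl⟩))
  have hsurj : Function.Surjective ψ := by
    have hadj : Algebra.adjoin (MvPolynomial V K) (Polynomial.monomial 1 '' Set.range M) =
        reesAlgebra I := by
      rw [← adjoin_monomial_eq_reesAlgebra, hI, Ideal.span, Submodule.map_span,
        Algebra.adjoin_span]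
    -- Modulo `𝔪` only the constants of the coefficient ring survive, so the degree-one classes
    -- generate over `K`.
    have hle : ∀ r : Polynomial (MvPolynomial V K),
        ∀ hr : r ∈ Algebra.adjoin (MvPolynomial V K) (Polynomial.monomial 1 '' Set.range M),
        ∀ h : r ∈ reesAlgebra I, π ⟨r, h⟩ ∈ ψ.range := by
      intro r hr
      induction hr using Algebra.adjoin_induction with
      | mem x hx =>
        rintro h
        obtain ⟨_, ⟨i, rfl⟩, rfl⟩ := hx
        exact ⟨X i, by simp [ψ, θ]⟩
      | algebraMap s =>
        intro h
        change π (algebraMap (MvPolynomial V K) (reesAlgebra I) s) ∈ _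
        clear h
        induction s using MvPolynomial.induction_on with
        | C a => exact ψ.range.algebraMap_mem a
        | add p q hp hq => rw [map_add, map_add]; exact add_mem hp hq
        | mul_X p i _ => rw [map_mul, map_mul, hπX, mul_zero]; exact zero_mem _
      | add x y hx hy ihx ihy =>
        intro h
        rw [hadj] at hx hy
        exact add_mem (ihx hx) (ihy hy)
      | mul x y hx hy ihx ihy =>
        intro h
        rw [hadj] at hx hy
        exact mul_mem (ihx hx) (ihy hy)
    intro f
    obtain ⟨r, rfl⟩ := Ideal.Quotient.mk_surjective f
    exact hle r (by rw [hadj]; exact r.2) r.2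
  have hker : RingHom.ker ψ = RingHom.ker (aeval (R := K) M) := by
    ext p
    rw [RingHom.mem_ker, RingHom.mem_ker]
    constructor
    · intro h
      have h' : θ p ∈ (idealOfVars V K).map (algebraMap (MvPolynomial V K) (reesAlgebra I)) :=
        Ideal.Quotient.eq_zero_iff_mem.1 h
      rw [← sum_homogeneousComponent p, map_sum]
      refine Finset.sum_eq_zero fun k _ => ?_
      apply aeval_monomial_homogeneousComponent_eq_zero he
      have := coeff_mem_of_mem_map_idealOfVars I h' k
      rwa [hθ, coeff_aeval_monomial_one, hI] at this
    · intro h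
      have : θ p = 0 := by
        apply Subtype.ext
        rw [hθ]
        ext1 k
        rw [coeff_aeval_monomial_one, hM, ← homogeneousComponent_aeval_monomial ht he, h]
        simp
      change π (θ p) = 0
      rw [this, map_zero]
  exact ⟨((Ideal.quotientKerAlgEquivOfSurjective hsurj).symm.trans
    (Ideal.quotientEquivAlgOfEq K hker)).trans
    (Ideal.quotientKerEquivRange (aeval (R := K) M))⟩

/-! ### Lower bound on the number of variables -/

-- Reading off the coefficients at the `e i` is a point derivation at the origin. It is onto `ι →
-- K`, yet its image is spanned by its values on `m` algebra generators.
open MvPolynomial in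
theorem card_le_of_aeval_monomial_range_algEquiv {K ι V : Type*} [Field K] [Fintype ι]
    {e : ι → V →₀ ℕ} {t m : ℕ} (ht : 0 < t) (he : ∀ i, (e i).degree = t)
    (hinj : Function.Injective e)
    (E : (aeval (R := K) fun i => (monomial (e i) 1 : MvPolynomial V K)).range ≃ₐ[K]
      MvPolynomial (Fin m) K) :
    Fintype.card ι ≤ m := by
  classical
  set φ := aeval (R := K) fun i => (monomial (e i) 1 : MvPolynomial V K) with hφ
  let L : MvPolynomial V K →ₗ[K] (ι → K) := LinearMap.pi fun i => lcoeff K (e i)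
  have hL : ∀ f i, L f i = coeff (e i) f := fun f i => rfl
  have hdvd : ∀ f ∈ φ.range, ∀ d, coeff d f ≠ 0 → t ∣ d.degree := by
    rintro _ ⟨p, rfl⟩
    change ∀ d, coeff d (φ p) ≠ 0 → _
    induction p using MvPolynomial.induction_on' with
    | monomial u a =>
      intro d hd
      have := (isHomogeneous_monomial (σ := ι) a (d := u) rfl).aeval _
        fun i => isHomogeneous_monomial (1 : K) (he i)
      by_contra h
      exact hd (this.coeff_eq_zero fun h' => h (h' ▸ dvd_mul_right _ _))
    | add p q hp hq =>
      intro d hd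
      rw [map_add, coeff_add] at hd
      by_cases h : coeff d (φ p) = 0
      · exact hq d (by simpa [h] using hd)
      · exact hp d h
  -- Exponents occurring in the range have degree divisible by `t`, so `e i` splits only as `0 + e
  -- i` or `e i + 0`.
  have hleib : ∀ f ∈ φ.range, ∀ g ∈ φ.range,
      L (f * g) = coeff 0 f • L g + coeff 0 g • L f := by
    intro f hf g hg
    ext i
    simp only [Pi.add_apply, Pi.smul_apply, hL, smul_eq_mul]
    have h0 : e i ≠ 0 := by
      intro h
      have := he i
      rw [h, map_zero] at this
      omega
    rw [coeff_mul, ← Finset.sum_subset (s₁ := {(0, e i), (e i, 0)})]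
    · rw [Finset.sum_pair (by simp [h0]), mul_comm (coeff (e i) f)]
    · intro x hx
      simp only [Finset.mem_insert, Finset.mem_singleton] at hx
      rcases hx with rfl | rfl <;> simp
    · intro x hx hx'
      rw [Finset.HasAntidiagonal.mem_antidiagonal] at hx
      by_contra h
      obtain ⟨h1, h2⟩ := mul_ne_zero_iff.1 h
      obtain ⟨a, ha⟩ := hdvd f hf _ h1
      obtain ⟨b, hb⟩ := hdvd g hg _ h2
      have hs : t * a + t * b = t * 1 := by
        rw [← ha, ← hb, ← map_add, hx, he, mul_one]
      rw [← mul_add] at hs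
      have hab := Nat.eq_of_mul_eq_mul_left ht hs
      apply hx'
      simp only [Finset.mem_insert, Finset.mem_singleton, Prod.ext_iff]
      rcases Nat.add_eq_one_iff.1 hab with ⟨rfl, -⟩ | ⟨-, rfl⟩
      · have : x.1 = 0 := (Finsupp.degree_eq_zero_iff _).1 (by simpa using ha)
        left
        exact ⟨this, by simpa [this] using hx⟩
      · have : x.2 = 0 := (Finsupp.degree_eq_zero_iff _).1 (by simpa using hb)
        right
        exact ⟨by simpa [this] using hx, this⟩
  let y : Fin m → MvPolynomial V K := fun j => E.symm (X j)
  have hspan : ∀ q, L (E.symm q : MvPolynomial V K) ∈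
      Submodule.span K (Set.range fun j => L (y j)) := by
    intro q
    induction q using MvPolynomial.induction_on with
    | C a =>
      have h : (E.symm (C a) : MvPolynomial V K) = C a :=
        congrArg Subtype.val (E.symm.commutes a)
      have : L (C a) = 0 := by
        ext i
        rw [hL, coeff_C, if_neg]
        · rfl
        · intro h
          have := he i
          rw [← h, map_zero] at this
          omega
      rw [h, this]
      exact zero_mem _
    | add p q hp hq =>
      rw [map_add, AddMemClass.coe_add, map_add]
      exact add_mem hp hq
    | mul_X p j hp =>
      rw [map_mul, MulMemClass.coe_mul, hleib _ (E.symm p).2 _ (E.symm (X j)).2]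
      exact add_mem (Submodule.smul_mem _ _ (Submodule.subset_span ⟨j, rfl⟩))
        (Submodule.smul_mem _ _ hp)
  have htop : Submodule.span K (Set.range fun j => L (y j)) = ⊤ := by
    rw [eq_top_iff, ← (Pi.basisFun K ι).span_eq, Submodule.span_le]
    rintro _ ⟨i, rfl⟩
    have hi : monomial (e i) 1 ∈ φ.range := ⟨X i, by simp [hφ]⟩
    have := hspan (E ⟨_, hi⟩)
    rw [E.symm_apply_apply] at this
    suffices h : L (monomial (e i) 1) = Pi.basisFun K ι i from h ▸ this
    ext k
    rw [hL, Pi.basisFun_apply, coeff_monomial, Pi.single_apply]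
    simp only [hinj.eq_iff, eq_comm]
  have h := finrank_range_le_card (R := K) fun j => L (y j)
  rw [Set.finrank, htop, finrank_top, Module.finrank_fintype_fun_eq_card,
    Fintype.card_fin] at h
  exact h

/-! ### Linear relations among cyclic windows -/

/-- The indicator function of `{i, i + 1, …, i + t - 1}` in `ℤ/n`, with multiplicities. -/
noncomputable def cyclicWindow (n t : ℕ) (i : ZMod n) : ZMod n →₀ ℕ :=
  ∑ j ∈ Finset.range t, Finsupp.single (i + j) 1

theorem degree_cyclicWindow (n t : ℕ) (i : ZMod n) : (cyclicWindow n t i).degree = t := by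
  simp [cyclicWindow]

theorem cyclicWindow_add_one (n t : ℕ) (i : ZMod n) :
    cyclicWindow n t (i + 1) + Finsupp.single i 1 =
      cyclicWindow n t i + Finsupp.single (i + t) 1 := by
  have h := Finset.sum_range_succ' (fun j : ℕ => Finsupp.single (i + (j : ZMod n)) 1) t
  rw [Finset.sum_range_succ] at h
  rw [cyclicWindow, cyclicWindow, h]
  simp [add_assoc, add_comm (1 : ZMod n)]

theorem cyclicWindow_apply_ne_zero_iff {n t : ℕ} {i v : ZMod n} :
    cyclicWindow n t i v ≠ 0 ↔ ∃ j < t, i + (j : ℕ) = v := by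
  simp [cyclicWindow, Finsupp.finsetSum_apply, Finsupp.single_apply]

/-- A proper window determines its start: the only point of the support whose predecessor lies
outside. -/
theorem cyclicWindow_injective {n t : ℕ} (ht : 0 < t) (htn : t < n) :
    Function.Injective (cyclicWindow n t) := by
  intro i k h
  have h₁ : cyclicWindow n t i i ≠ 0 := cyclicWindow_apply_ne_zero_iff.2 ⟨0, ht, by simp⟩
  have h₂ : ¬ cyclicWindow n t i (i - 1) ≠ 0 := by
    rw [cyclicWindow_apply_ne_zero_iff]
    rintro ⟨j, hj, hji⟩
    have : ((j + 1 : ℕ) : ZMod n) = 0 := by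
      push_cast
      linear_combination hji
    rw [ZMod.natCast_eq_zero_iff] at this
    have := Nat.le_of_dvd (by omega) this
    omega
  rw [h] at h₁ h₂
  obtain ⟨j, hj, hji⟩ := cyclicWindow_apply_ne_zero_iff.1 h₁
  rcases j with _ | j
  · simpa using hji.symm
  · refine (h₂ (cyclicWindow_apply_ne_zero_iff.2 ⟨j, by omega, ?_⟩)).elim
    push_cast at hji
    linear_combination hji

/-- Sum `cyclicWindow_add_one` over a class mod `d`: translation by `t` preserves the class, so the
point masses cancel. -/
theorem sum_cyclicWindow_fiber_eq {n t d : ℕ} [NeZero n] [NeZero d] (hn : d ∣ n) (ht : d ∣ t)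
    (c : ZMod d) :
    ∑ j with ZMod.castHom hn (ZMod d) j = c, cyclicWindow n t j =
      ∑ j with ZMod.castHom hn (ZMod d) j = 0, cyclicWindow n t j := by
  set π := ZMod.castHom hn (ZMod d)
  have hshift : ∀ (s : ZMod n) (c : ZMod d) (f : ZMod n → ZMod n →₀ ℕ),
      ∑ j with π j = c, f (j + s) = ∑ j with π j = c + π s, f j := by
    intro s c f
    refine Finset.sum_bij' (fun j _ => j + s) (fun j _ => j - s) ?_ ?_ ?_ ?_ ?_ <;>
      simp +contextual
  have hstep : ∀ c, ∑ j with π j = c + 1, cyclicWindow n t j =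
      ∑ j with π j = c, cyclicWindow n t j := by
    intro c
    have h := hshift 1 c (cyclicWindow n t)
    rw [map_one] at h
    have hd := hshift t c fun j => Finsupp.single j 1
    rw [map_natCast, (ZMod.natCast_eq_zero_iff t d).2 ht, add_zero] at hd
    apply add_right_cancel (b := ∑ j with π j = c, Finsupp.single j 1)
    rw [← h, ← Finset.sum_add_distrib]
    conv_rhs => rw [← hd]
    rw [← Finset.sum_add_distrib]
    exact Finset.sum_congr rfl fun j _ => cyclicWindow_add_one n t j
  rw [← ZMod.natCast_zmod_val c]
  induction c.val with
  | zero => simp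
  | succ k ih => rw [Nat.cast_succ, hstep, ih]

/-- By Bézout, `gcd(n, t)` is a multiple of `t` modulo `n`. -/
theorem eq_natCast_mod_gcd_of_add_periodic {n t : ℕ} [NeZero n] {α : Type*} {a : ZMod n → α}
    (ha : ∀ v, a (v + t) = a v) (v : ZMod n) : a v = a ((v.val % n.gcd t : ℕ) : ZMod n) := by
  have hmul : ∀ (k : ℕ) (v : ZMod n), a (v + (k : ZMod n) * t) = a v := by
    intro k
    induction k with
    | zero => simp
    | succ k ih => intro v; rw [Nat.cast_succ, add_mul, one_mul, ← add_assoc, ha, ih]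
  have hgcd : ∃ k : ℕ, ((n.gcd t : ℕ) : ZMod n) = k * t := by
    refine ⟨((n.gcdB t : ℤ) : ZMod n).val, ?_⟩
    have := congrArg (Int.cast : ℤ → ZMod n) (Nat.gcd_eq_gcd_ab n t)
    push_cast at this
    rw [ZMod.natCast_zmod_val, this, ZMod.natCast_self]
    ring
  obtain ⟨k, hk⟩ := hgcd
  conv_lhs => rw [← ZMod.natCast_zmod_val v, ← Nat.mod_add_div v.val (n.gcd t)]
  rw [Nat.cast_add, Nat.cast_mul, hk, mul_right_comm, ← Nat.cast_mul, hmul]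

/-- The coefficient at `v` is the sum of `a` over the `t` indices ending at `v`; comparing
neighbouring sums gives period `t`, hence period `gcd(n, t)`. By `ha0`, `a` then lives on a single
residue class, where it is constant. -/
theorem eq_zero_of_sum_mul_cyclicWindow_eq_zero {n t : ℕ} [NeZero n] (ht : 0 < t)
    {a : ZMod n → ℤ} (ha : ∀ v, ∑ i, a i * cyclicWindow n t i v = 0)
    (ha0 : ∀ i : ZMod n, i.val < n.gcd t - 1 → a i = 0) : a = 0 := by
  have hwin : ∀ v, ∑ j ∈ Finset.range t, a (v - j) = 0 := by
    intro v
    rw [← ha v]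
    simp only [cyclicWindow, Finsupp.finsetSum_apply, Finsupp.single_apply, Nat.cast_sum,
      Finset.mul_sum]
    rw [Finset.sum_comm]
    refine Finset.sum_congr rfl fun j _ => ?_
    simp [← eq_sub_iff_add_eq]
  have hper : ∀ v, a (v + t) = a v := by
    intro v
    have h := Finset.sum_range_succ' (fun j : ℕ => a (v + t - j)) t
    rw [Finset.sum_range_succ, hwin] at h
    have h' : ∑ j ∈ Finset.range t, a (v + t - ((j + 1 : ℕ) : ZMod n)) = 0 := by
      rw [← hwin (v + t - 1)]
      refine Finset.sum_congr rfl fun j _ => ?_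
      congr 1
      push_cast
      ring
    rw [h'] at h
    simpa using h.symm
  have hd : 0 < n.gcd t := Nat.gcd_pos_of_pos_right _ ht
  have hdn : n.gcd t ≤ n := Nat.gcd_le_left _ (NeZero.pos n)
  have hval : ∀ k < n.gcd t, ((k : ℕ) : ZMod n).val = k := fun k hk =>
    ZMod.val_cast_of_lt (by omega)
  have hmod := eq_natCast_mod_gcd_of_add_periodic hper
  set w : ZMod n := ((n.gcd t - 1 : ℕ) : ZMod n)
  have hor : ∀ v, a v = 0 ∨ a v = a w := by
    intro v
    have hlt := Nat.mod_lt v.val hd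
    rw [hmod v]
    by_cases h : v.val % n.gcd t < n.gcd t - 1
    · exact Or.inl (ha0 _ (by rwa [hval _ hlt]))
    · right
      rw [show v.val % n.gcd t = n.gcd t - 1 by omega]
  have hw : a w = 0 := by
    by_contra h0
    -- Multiplying by `a w` makes every term `0` or `(a w)²`, so the `j = 0` term must vanish.
    have hsq : ∑ j ∈ Finset.range t, a w * a (w - j) = 0 := by rw [← Finset.mul_sum, hwin, mul_zero]
    rw [Finset.sum_eq_zero_iff_of_nonneg] at hsq
    · have := hsq 0 (by simpa using ht)
      simp [h0] at this
    · intro j _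
      rcases hor (w - j) with h | h <;> rw [h]
      · simp
      · exact mul_self_nonneg _
  ext v
  rcases hor v with h | h
  · exact h
  · rw [h, hw]; rfl

theorem cyclicWindow_sum_injective {n t : ℕ} [NeZero n] (ht : 0 < t) :
    Function.Injective fun u : {i : ZMod n | n.gcd t - 1 ≤ i.val} →₀ ℕ =>
      u.sum fun i k => k • cyclicWindow n t i := by
  intro u w h
  let ext : ({i : ZMod n | n.gcd t - 1 ≤ i.val} →₀ ℕ) → ZMod n → ℤ := fun u i =>
    if hi : n.gcd t - 1 ≤ i.val then u ⟨i, hi⟩ else 0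
  have hin : ∀ u (i : {i : ZMod n | n.gcd t - 1 ≤ i.val}), ext u i = u i :=
    fun u i => dif_pos i.2
  have hout : ∀ u (i : ZMod n), ¬ n.gcd t - 1 ≤ i.val → ext u i = 0 := fun u i hi => dif_neg hi
  have hext : ∀ u v, ∑ i, ext u i * cyclicWindow n t i v =
      ((u.sum fun i k => k • cyclicWindow n t i) v : ℕ) := by
    intro u v
    rw [← Fintype.sum_subtype_add_sum_subtype fun i : ZMod n => n.gcd t - 1 ≤ i.val,
      Finset.sum_eq_zero (s := Finset.univ (α := {i : ZMod n // ¬ n.gcd t - 1 ≤ i.val}))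
        fun i _ => by rw [hout u i i.2, zero_mul],
      add_zero,
      Finsupp.sum_fintype u (fun i k => k • cyclicWindow n t i) fun _ => zero_smul ℕ _,
      Finsupp.finsetSum_apply, Nat.cast_sum]
    refine Finset.sum_congr rfl fun i _ => ?_
    rw [hin u i, Finsupp.smul_apply, smul_eq_mul, Nat.cast_mul]
  have hz := eq_zero_of_sum_mul_cyclicWindow_eq_zero ht (a := ext u - ext w) (by
    intro v
    simp only [Pi.sub_apply, sub_mul, Finset.sum_sub_distrib, hext]
    rw [sub_eq_zero]
    exact congrArg (fun f : ZMod n →₀ ℕ => (f v : ℤ)) h) (by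
    intro i hi
    rw [Pi.sub_apply, hout _ _ hi.not_ge, hout _ _ hi.not_ge, sub_zero])
  ext i
  have := congrFun (sub_eq_zero.1 hz) i
  rw [hin, hin] at this
  exact_mod_cast this

theorem natCard_gcd_sub_one_le_val {n t : ℕ} [NeZero n] :
    Nat.card {i : ZMod n | n.gcd t - 1 ≤ i.val} = n - n.gcd t + 1 := by
  have hd : 0 < n.gcd t := Nat.gcd_pos_of_pos_left _ (NeZero.pos n)
  have hdn : n.gcd t ≤ n := Nat.gcd_le_left _ (NeZero.pos n)
  have e : {i : ZMod n | n.gcd t - 1 ≤ i.val} ≃ Finset.Ico (n.gcd t - 1) n :=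
    { toFun := fun i => ⟨i.1.val, Finset.mem_Ico.2 ⟨i.2, ZMod.val_lt _⟩⟩
      invFun := fun k => ⟨(k : ℕ), by
        have := Finset.mem_Ico.1 k.2
        rw [Set.mem_ofPred_eq, ZMod.val_cast_of_lt this.2]
        exact this.1⟩
      left_inv := fun i => Subtype.ext (ZMod.natCast_zmod_val _)
      right_inv := fun k => Subtype.ext (ZMod.val_cast_of_lt (Finset.mem_Ico.1 k.2).2) }
  rw [Nat.card_congr e]
  rw [Nat.card_eq_fintype_card, Fintype.card_coe, Nat.card_Ico]
  omega

theorem exists_cyclicWindow_relation {n t : ℕ} [NeZero n] (ht : 0 < t) {i : ZMod n}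
    (hi : i.val < n.gcd t - 1) :
    ∃ s s' : Finset (ZMod n), ↑s ⊆ {i : ZMod n | n.gcd t - 1 ≤ i.val} ∧
      ↑s' ⊆ {i : ZMod n | n.gcd t - 1 ≤ i.val} ∧
      cyclicWindow n t i + ∑ j ∈ s, cyclicWindow n t j = ∑ j ∈ s', cyclicWindow n t j := by
  have hd : 0 < n.gcd t := Nat.gcd_pos_of_pos_right _ ht
  have : NeZero (n.gcd t) := ⟨hd.ne'⟩
  set π := ZMod.castHom (Nat.gcd_dvd_left n t) (ZMod (n.gcd t)) with hπ
  have hval : ∀ j : ZMod n, (π j).val = j.val % n.gcd t := by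
    intro j
    rw [← ZMod.val_natCast, ← ZMod.natCast_zmod_val j, map_natCast]
    simp
  -- Only the least member `i` of its class lies outside the basis; the class of `gcd(n, t) - 1`
  -- lies wholly inside.
  refine ⟨({j | π j = π i} : Finset _).erase i, ({j | π j = ((n.gcd t - 1 : ℕ) : ZMod _)} : Finset _),
    ?_, ?_, ?_⟩
  · intro j hj
    simp only [Finset.coe_erase, Finset.coe_filter, Finset.mem_univ, true_and, Set.mem_sdiff,
      Set.mem_ofPred_eq, Set.mem_singleton_iff] at hj ⊢
    by_contra h
    have := congrArg ZMod.val hj.1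
    rw [hval, hval, Nat.mod_eq_of_lt (by omega), Nat.mod_eq_of_lt (by omega)] at this
    exact hj.2 (ZMod.val_injective n this)
  · intro j hj
    simp only [Finset.coe_filter, Finset.mem_univ, true_and, Set.mem_ofPred_eq] at hj ⊢
    have := congrArg ZMod.val hj
    rw [hval, ZMod.val_cast_of_lt (by omega)] at this
    rw [← this]
    exact Nat.mod_le _ _
  · rw [Finset.add_sum_erase _ _ (by simp), sum_cyclicWindow_fiber_eq _ (Nat.gcd_dvd_right n t),
      sum_cyclicWindow_fiber_eq (Nat.gcd_dvd_left n t) (Nat.gcd_dvd_right n t) (Nat.cast _)]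

/-! ### Paths in the cycle -/

/-- A path cannot change direction, since turning back would revisit a vertex. -/
theorem SimpleGraph.Walk.IsPath.support_eq_of_adj_iff_sub {n : ℕ} {G : SimpleGraph (ZMod n)}
    (hG : ∀ u v, G.Adj u v → u - v = 1 ∨ v - u = 1) {u v : ZMod n} {p : G.Walk u v}
    (hp : p.IsPath) :
    p.support = (List.range (p.length + 1)).map (fun j : ℕ => u + (j : ZMod n)) ∨
      p.support = (List.range (p.length + 1)).map (fun j : ℕ => u - (j : ZMod n)) := by
  induction p with
  | nil => simp
  | @cons u v w h q ih =>
    rw [SimpleGraph.Walk.cons_isPath_iff] at hp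
    obtain ⟨hq, hu⟩ := hp
    rw [SimpleGraph.Walk.support_cons, SimpleGraph.Walk.length_cons, List.range_succ_eq_map]
    simp only [List.map_cons, List.map_map, Nat.cast_zero, add_zero, sub_zero, List.cons.injEq,
      true_and]
    rcases ih hq with ih | ih <;> rcases hG _ _ h with huv | huv
    · rcases Nat.eq_zero_or_pos q.length with h0 | h0
      · right
        rw [ih, h0]
        simp [← huv]
      · refine (hu ?_).elim
        rw [ih, List.mem_map]
        exact ⟨1, by simpa using h0, by rw [Nat.cast_one]; linear_combination -huv⟩
    · left
      rw [ih]
      refine List.map_congr_left fun j _ => ?_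
      simp only [Function.comp, Nat.cast_succ]
      linear_combination huv
    · right
      rw [ih]
      refine List.map_congr_left fun j _ => ?_
      simp only [Function.comp, Nat.cast_succ]
      linear_combination -huv
    · rcases Nat.eq_zero_or_pos q.length with h0 | h0
      · left
        rw [ih, h0]
        simp [← huv]
      · refine (hu ?_).elim
        rw [ih, List.mem_map]
        exact ⟨1, by simpa using h0, by rw [Nat.cast_one]; linear_combination huv⟩

theorem exists_isPath_support_eq_of_adj_sub {n : ℕ} {G : SimpleGraph (ZMod n)}
    (hG : ∀ u, G.Adj u (u + 1)) (l : ℕ) (hl : l < n) (u : ZMod n) :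
    ∃ (v : ZMod n) (p : G.Walk u v), p.IsPath ∧ p.length = l ∧
      p.support = (List.range (l + 1)).map (fun j : ℕ => u + (j : ZMod n)) := by
  have hw : ∀ (l : ℕ) (u : ZMod n), ∃ (v : ZMod n) (p : G.Walk u v), p.length = l ∧
      p.support = (List.range (l + 1)).map (fun j : ℕ => u + (j : ZMod n)) := by
    intro l
    induction l with
    | zero => exact fun u => ⟨u, .nil, rfl, by simp⟩
    | succ l ih =>
      intro u
      obtain ⟨v, p, hp, hs⟩ := ih (u + 1)
      refine ⟨v, .cons (hG u) p, by simp [hp], ?_⟩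
      rw [SimpleGraph.Walk.support_cons, hs, List.range_succ_eq_map (n := l + 1), List.map_cons,
        List.map_map, Nat.cast_zero, add_zero]
      congr 1
      refine List.map_congr_left fun j _ => ?_
      simp only [Function.comp, Nat.cast_succ]
      ring
  obtain ⟨v, p, hp, hs⟩ := hw l u
  refine ⟨v, p, ?_, hp, hs⟩
  rw [SimpleGraph.Walk.isPath_def, hs]
  refine List.Nodup.map_on ?_ List.nodup_range
  intro x hx y hy hxy
  rw [List.mem_range] at hx hy
  have := (ZMod.natCast_eq_natCast_iff' _ _ _).1 (add_left_cancel hxy)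
  rwa [Nat.mod_eq_of_lt (by omega), Nat.mod_eq_of_lt (by omega)] at this

open MvPolynomial in
theorem pathIdeal_eq_span_cyclicWindow {K : Type*} [Field K] {n t : ℕ} (ht : 0 < t) (htn : t < n)
    {G : SimpleGraph (ZMod n)} (hG : ∀ u v, G.Adj u v ↔ u - v = 1 ∨ v - u = 1) :
    pathIdeal K G t = Ideal.span (Set.range fun i => monomial (cyclicWindow n t i) 1) := by
  have hmon : ∀ i : ZMod n, (monomial (cyclicWindow n t i) 1 : MvPolynomial (ZMod n) K) =
      ∏ j ∈ Finset.range t, X (i + (j : ZMod n)) := by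
    intro i
    rw [cyclicWindow, monomial_sum_one]
    rfl
  have hlist : ∀ f : ℕ → ZMod n, (((List.range t).map f).map
      fun i => (X i : MvPolynomial (ZMod n) K)).prod = ∏ j ∈ Finset.range t, X (f j) := by
    intro f
    rw [List.map_map]
    rfl
  refine congrArg Ideal.span ?_
  ext f
  constructor
  · rintro ⟨u, v, p, hp, hl, rfl⟩
    rcases hp.support_eq_of_adj_iff_sub fun u v h => (hG u v).1 h with h | h
    · refine ⟨u, ?_⟩
      dsimp only
      rw [h, hl, hlist, hmon]
    -- A descending path covers the window that starts at its last vertex.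
    · refine ⟨u - ((t - 1 : ℕ) : ZMod n), ?_⟩
      dsimp only
      rw [h, hl, hlist, hmon, ← Finset.prod_range_reflect]
      refine Finset.prod_congr rfl fun j hj => ?_
      rw [Finset.mem_range] at hj
      have h : ((t - 1 : ℕ) : ZMod n) = ((t - 1 - j : ℕ) : ZMod n) + j := by
        rw [← Nat.cast_add, Nat.sub_add_cancel (by omega)]
      rw [h]
      congr 1
      ring
  · rintro ⟨u, rfl⟩
    obtain ⟨v, p, hp, hl, hs⟩ := exists_isPath_support_eq_of_adj_sub
      (fun u => (hG u (u + 1)).2 (Or.inr (add_sub_cancel_left _ _))) (t - 1) (by omega) u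
    refine ⟨u, v, p, hp, by omega, ?_⟩
    dsimp only
    rw [hs, Nat.sub_add_cancel ht, hlist, hmon]

/-! ### Dimension and polynomiality of the fiber cone -/

theorem ringKrullDim_and_isPolynomialRing_fiberCone_pathIdeal {K : Type*} [Field K]
    {n t : ℕ} (ht : 1 < t) (htn : t + 1 < n) {G : SimpleGraph (ZMod n)} (hG : ∀ u v, G.Adj u v ↔ u - v = 1 ∨ v - u = 1) :
    ringKrullDim (FiberCone (pathIdeal K G t)) = ((n - Nat.gcd n t + 1 : ℕ) : WithBot ℕ∞) ∧
      (IsPolynomialRing K (FiberCone (pathIdeal K G t)) ↔ Nat.gcd n t = 1) := by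
  have : NeZero n := ⟨by omega⟩
  have ht0 : 0 < t := by omega
  have hd : 0 < n.gcd t := Nat.gcd_pos_of_pos_right _ ht0
  have hdn : n.gcd t ≤ n := Nat.gcd_le_left _ (NeZero.pos n)
  obtain ⟨E⟩ := nonempty_fiberCone_algEquiv ht0 (degree_cyclicWindow n t) _
    (pathIdeal_eq_span_cyclicWindow (K := K) ht0 (by omega) hG)
  have hdim : ringKrullDim (FiberCone (pathIdeal K G t)) =
      ((n - Nat.gcd n t + 1 : ℕ) : WithBot ℕ∞) := by
    rw [ringKrullDim_eq_of_ringEquiv E.toRingEquiv, ringKrullDim_aeval_monomial_range _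
      {i : ZMod n | n.gcd t - 1 ≤ i.val} (cyclicWindow_sum_injective ht0)
      fun i hi => exists_cyclicWindow_relation ht0 (not_le.1 hi), natCard_gcd_sub_one_le_val]
  refine ⟨hdim, ?_, ?_⟩
  · rintro ⟨m, ⟨F⟩⟩
    have hm := ringKrullDim_eq_of_ringEquiv F.toRingEquiv
    rw [hdim, MvPolynomial.ringKrullDim_of_isNoetherianRing, ringKrullDim_eq_zero_of_field,
      zero_add, Nat.card_fin] at hm
    have hm' : n - n.gcd t + 1 = m := by exact_mod_cast hm
    have := card_le_of_aeval_monomial_range_algEquiv ht0 (degree_cyclicWindow n t)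
      (cyclicWindow_injective ht0 (by omega)) (E.symm.trans F)
    rw [ZMod.card] at this
    omega
  · intro h1
    have hind : AlgebraicIndependent K fun i : ZMod n =>
        (MvPolynomial.monomial (cyclicWindow n t i) 1 : MvPolynomial (ZMod n) K) :=
      (algebraicIndependent_monomial (K := K) _ (cyclicWindow_sum_injective ht0)).comp
        (fun i : ZMod n => ⟨i, by simp [h1]⟩) fun i j h => congrArg Subtype.val h
    exact ⟨n, ⟨E.trans ((AlgEquiv.ofInjective _ hind).symm.trans
      (MvPolynomial.renameEquiv K (Fintype.equivFinOfCardEq (ZMod.card n))))⟩⟩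

theorem mainTheorem6 {K : Type*} [Field K] (n t : ℕ) (ht : 1 < t) (htn : t + 1 < n) :
    ringKrullDim (FiberCone (pathIdeal K (SimpleGraph.cycleGraph n) t)) =
        ((n - Nat.gcd n t + 1 : ℕ) : WithBot ℕ∞) ∧
      (IsPolynomialRing K (FiberCone (pathIdeal K (SimpleGraph.cycleGraph n) t)) ↔
        Nat.gcd n t = 1) := by
  -- With `n = k + 2`, `ZMod n` unfolds to `Fin n`, the vertex type of the cycle graph.
  obtain ⟨k, rfl⟩ : ∃ k, n = k + 2 := ⟨n - 2, by omega⟩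
  exact ringKrullDim_and_isPolynomialRing_fiberCone_pathIdeal ht htn
    (G := (SimpleGraph.cycleGraph (k + 2) : SimpleGraph (Fin (k + 2))))
    fun u v => SimpleGraph.cycleGraph_adj
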